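/- Let $n\ge 2$, $2\le j\le n$ and $k\ge 1$ be integers. For a prime power $q$ let $w_q(n)$ be the Witt index of $\mathbb F_q^n$ with the standard inner product, i.e. the largest dimension of a self-orthogonal code $C\le\mathbb F_q^n$ (a linear subspace with $C\subseteq C^\perp$); it depends on $q$ only through whether $q$ is even, $q\equiv1\pmod 4$ or $q\equiv3\pmod 4$. For $k\le w_q(n)$ let $\overline A_q^{(j)}(n,k,k)$ be the average, over all $k$-dimensional self-orthogonal codes $C\le\mathbb F_q^n$, of the number of codewords of Hamming weight $j$ in $C$. Below, $f(q)\sim g(q)$ means that $f(q)/g(q)\to1$ as $q\to\infty$ through the prime powers $q$ with $k\le w_q(n)$ that satisfy the congruence condition stated, if any. Then \[ \overline A_q^{(j)}(n,k,k)\sim\binom nj q^{\,j-n+k}, \] with the following exceptions, both for $j=2$: \[ \overline A_q^{(2)}(n,k,k)=0\quad\text{for every prime power } q\equiv3\pmod 4 \text{ with } k\le w_q(n), \] \[ \overline A_q^{(2)}(n,k,k)\sim2\binom n2q^{\,2-n+k}\quad\text{for } q\equiv1\pmod 4,\ \text{if } n\ge3 . \] That is, the general formula holds for $j\ge3$ with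 no condition on $q$ (all prime powers together), for $j=2$ with $q$ even, and for $j=n=2$ (so $k=1$) with $q\equiv1\pmod 4$. -/

import Mathlib

open Filter Topology

noncomputable section

namespace SelfOrthogonalCodes

/-- The orthogonal of the code `C ≤ Fⁿ` with respect to the standard inner product. -/
def dual {F : Type*} [Field F] {n : ℕ} (C : Submodule F (Fin n → F)) :
    Submodule F (Fin n → F) :=
  LinearMap.BilinForm.orthogonal (dotProductBilin F F) C

/-- Membership in the orthogonal, spelled out. -/
theorem mem_dual {F : Type*} [Field F] {n : ℕ} (C : Submodule F (Fin n → F)) (v : Fin n → F) :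
    v ∈ dual C ↔ ∀ w ∈ C, ∑ i, w i * v i = 0 := Iff.rfl

/-- The set of `ℓ`-complementary codes of dimension `k` in `Fⁿ`: those `C` whose radical
`C ∩ C^⊥` has dimension `ℓ`. -/
def complementaryCodes (F : Type*) [Field F] (n k l : ℕ) : Set (Submodule F (Fin n → F)) :=
  {C | Module.finrank F C = k ∧ Module.finrank F (C ⊓ dual C : Submodule F (Fin n → F)) = l}

/-- The `ℓ = k` case is exactly self-orthogonality, `C ⊆ C^⊥`. -/
theorem mem_complementaryCodes_self {F : Type*} [Field F] {n k : ℕ}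
    (C : Submodule F (Fin n → F)) :
    C ∈ complementaryCodes F n k k ↔ Module.finrank F C = k ∧ C ≤ dual C := by
  constructor
  · rintro ⟨h1, h2⟩
    refine ⟨h1, ?_⟩
    have h := Submodule.eq_of_le_of_finrank_eq (inf_le_left : C ⊓ dual C ≤ C) (h2.trans h1.symm)
    exact inf_eq_left.mp h
  · rintro ⟨h1, h2⟩
    exact ⟨h1, by rw [inf_eq_left.mpr h2, h1]⟩

/-- The Witt index of `Fⁿ` with the standard inner product: the maximal dimension of a
self-orthogonal code. -/
def wittIndex (F : Type*) [Field F] (n : ℕ) : ℕ :=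
  sSup {k | ∃ C : Submodule F (Fin n → F), C ≤ dual C ∧ Module.finrank F C = k}

open Classical in
/-- The number of codewords of Hamming weight `j` in the code `C`. -/
def weightCount {F : Type*} [Field F] {n : ℕ} (C : Submodule F (Fin n → F)) (j : ℕ) : ℕ :=
  Set.ncard {v : Fin n → F | v ∈ C ∧ hammingNorm v = j}

/-- The aggregate weight distribution of the `ℓ`-complementary `[n, k]` codes over `F`. -/
def aggregateWeight (F : Type*) [Field F] (n k l j : ℕ) : ℕ :=
  ∑ᶠ C ∈ complementaryCodes F n k l, weightCount C j

/-- The average weight distribution of the `ℓ`-complementary `[n, k]` codes over `F`. -/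
def averageWeight (F : Type*) [Field F] (n k l j : ℕ) : ℝ :=
  (aggregateWeight F n k l j : ℝ) / ((complementaryCodes F n k l).ncard : ℝ)

/-- `f(q) ∼ g(q)`, that is `f(q) / g(q) → 1`, for `q → ∞` subject to `q ∈ S`. -/
def AsympOn (S : Set ℕ) (f g : ℕ → ℝ) : Prop :=
  Tendsto (fun q => f q / g q) (atTop ⊓ 𝓟 S) (𝓝 1)

end SelfOrthogonalCodes

end

namespace SelfOrthogonalCodes

/-! Count pairs (isotropic vector, code through it) twice. If every nonzero isotropic vector lay on
the same number of the N self-orthogonal codes of dimension k, that number would be N(q^k - 1)/|I|,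
with I the set of nonzero isotropic vectors, and the average would be |I_j|(q^k - 1)/|I|, with I_j
those of weight j. Since |I| ~ q^(n-1) for n ≥ 3, everything then rests on |I_j|, which is
binom(n,j) times the number of zeros of a sum of j squares with all coordinates nonzero
(`card_isotropicOfWeight`).

That number is q^(j-1) to first order for j ≥ 3 (`abs_squareSumCount_sub_le`), by a Jacobi sum for
two squares followed by induction. For j = 2 it depends on -1: it is 2(q-1) if -1 is a square in odd
characteristic, 0 if it is not, and close to q in characteristic 2. This is the source of both
exceptions. For n = j = 2 the sets I and I_2 coincide, so the factor 2 cancels.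

Equal distribution comes from explicit isometries (`exists_isometry_apply_eq`) moving u to v when
u·v ≠ 0, and from an isotropic vector orthogonal to neither when u·v = 0. In characteristic 2 this
fails for multiples of the all-one vector. For k = 1 this is harmless, each isotropic vector
spanning exactly one code; for k ≥ 2 these at most q vectors are split off and shown negligible
(`exists_averageWeight_mul_eq`). -/

open Classical in
/-- The number of `x ∈ A ^ m` whose sum of squares is `c`. -/
noncomputable def squareSumCount {F : Type*} [Field F] (A : Finset F) : ℕ → F → ℕ
  | 0, c => if c = 0 then 1 else 0
  | m + 1, c => ∑ a ∈ A, squareSumCount A m (c - a ^ 2)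

/-! ### Representations by sums of squares over a finite field -/

section Counting

variable {F : Type*} [Field F]

open Classical in
theorem card_filter_sq_eq_le (A : Finset F) (c : F) :
    ({a ∈ A | a ^ 2 = c} : Finset F).card ≤ 2 := by
  rcases (({a ∈ A | a ^ 2 = c} : Finset F)).eq_empty_or_nonempty with h | ⟨b, hb⟩
  · simp [h]
  · refine (Finset.card_le_card (t := {b, -b}) fun a ha => ?_).trans Finset.card_le_two
    simp only [Finset.mem_filter, Finset.mem_insert, Finset.mem_singleton] at *
    exact sq_eq_sq_iff_eq_or_eq_neg.mp (ha.2.trans hb.2.symm)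

open Classical in
theorem squareSumCount_one (A : Finset F) (c : F) :
    squareSumCount A 1 c = ({a ∈ A | a ^ 2 = c} : Finset F).card := by
  simp only [squareSumCount, Finset.card_filter, sub_eq_zero, eq_comm (a := c)]

theorem squareSumCount_one_le (A : Finset F) (c : F) : squareSumCount A 1 c ≤ 2 :=
  (squareSumCount_one A c).trans_le (card_filter_sq_eq_le A c)

theorem squareSumCount_mono {A B : Finset F} (h : A ⊆ B) (m : ℕ) (c : F) :
    squareSumCount A m c ≤ squareSumCount B m c := by
  induction m generalizing c with
  | zero => rfl
  | succ m ih =>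
    exact (Finset.sum_le_sum fun a _ => ih _).trans (Finset.sum_le_sum_of_subset h)

variable [Fintype F]

-- Links the recursive count to vectors with prescribed support: one coordinate is fixed at a time
-- and reset to zero.
open Classical in
theorem card_supported_squareSum {ι : Type*} [Fintype ι] (A : Finset F) (s : Finset ι) (c : F) :
    ({x : ι → F | (∀ i ∈ s, x i ∈ A) ∧ (∀ i ∉ s, x i = 0) ∧ ∑ i ∈ s, x i ^ 2 = c} :
      Finset (ι → F)).card = squareSumCount A s.card c := by
  induction s using Finset.induction_on generalizing c with
  | empty =>
    simp only [Finset.card_empty, squareSumCount]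
    split_ifs with h
    · rw [Finset.card_eq_one]
      refine ⟨0, ?_⟩
      ext x
      simp [h, funext_iff]
    · simp [Ne.symm h]
  | insert i s hi ih =>
    rw [Finset.card_insert_of_notMem hi, squareSumCount,
      Finset.card_eq_sum_card_fiberwise (f := fun x => x i) (t := A)
        (by intro x hx; simp at hx; exact hx.1.1)]
    refine Finset.sum_congr rfl fun a ha => ?_
    rw [← ih]
    refine Finset.card_nbij' (fun x => Function.update x i 0) (fun x => Function.update x i a)
      ?_ ?_ ?_ ?_
    · intro x hx
      simp only [Finset.mem_insert, forall_eq_or_imp, Finset.coe_filter, Finset.mem_filter,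
        Finset.mem_univ, true_and, Set.mem_ofPred_eq, Finset.sum_insert hi] at hx ⊢
      obtain ⟨⟨⟨-, h1⟩, h2, h3⟩, h4⟩ := hx
      refine ⟨fun l hl => ?_, fun l hl => ?_, ?_⟩
      · rw [Function.update_of_ne (by rintro rfl; exact hi hl)]; exact h1 l hl
      · by_cases h : l = i
        · simp [h]
        · rw [Function.update_of_ne h]; exact h2 l (by simp [h, hl])
      · rw [← h3, h4, add_sub_cancel_left]
        exact Finset.sum_congr rfl fun l hl => by
          rw [Function.update_of_ne (by rintro rfl; exact hi hl)]
    · intro x hx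
      simp only [Finset.mem_insert, forall_eq_or_imp, Finset.coe_filter, Finset.mem_filter,
        Finset.mem_univ, true_and, Set.mem_ofPred_eq, Finset.sum_insert hi,
        Function.update_self] at hx ⊢
      obtain ⟨h1, h2, h3⟩ := hx
      refine ⟨⟨⟨ha, fun l hl => ?_⟩, fun l hl => ?_, ?_⟩, trivial⟩
      · rw [Function.update_of_ne (by rintro rfl; exact hi hl)]; exact h1 l hl
      · push Not at hl
        rw [Function.update_of_ne hl.1]; exact h2 l hl.2
      · rw [Finset.sum_congr rfl fun l hl => by
          rw [Function.update_of_ne (by rintro rfl; exact hi hl)], h3]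
        ring
    · intro x hx
      simp only [Finset.coe_filter, Finset.mem_filter, Set.mem_ofPred_eq] at hx
      simp [← hx.2]
    · intro x hx
      simp only [Finset.coe_filter, Set.mem_ofPred_eq] at hx
      have : x i = 0 := hx.2.2.1 i hi
      simp [← this]

theorem squareSumCount_two_le (A : Finset F) (c : F) :
    squareSumCount A 2 c ≤ 2 * Fintype.card F := by
  rw [squareSumCount]
  refine (Finset.sum_le_card_nsmul _ _ 2 fun a _ => squareSumCount_one_le A _).trans ?_
  rw [smul_eq_mul, mul_comm]
  exact Nat.mul_le_mul_left _ (Finset.card_le_univ A)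

theorem squareSumCount_univ_one (h2 : ringChar F ≠ 2) [DecidableEq F] (c : F) :
    (squareSumCount (Finset.univ : Finset F) 1 c : ℤ) = quadraticChar F c + 1 := by
  classical
  rw [squareSumCount_one, ← quadraticChar_card_sqrts h2 c]
  congr 2
  ext; simp

/-- The number of the representations of a nonzero element as a sum of two squares. -/
theorem squareSumCount_univ_two (h2 : ringChar F ≠ 2) [DecidableEq F] {c : F} (hc : c ≠ 0) :
    (squareSumCount (Finset.univ : Finset F) 2 c : ℤ)
      = Fintype.card F - quadraticChar F (-1) := by
  -- Group by the value d of the square, which has χ(d) + 1 square roots.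
  have key : ∀ g : F → ℤ, ∑ a : F, g (a ^ 2) = ∑ d : F, (quadraticChar F d + 1) * g d := by
    intro g
    rw [← Finset.sum_fiberwise' (Finset.univ : Finset F) (fun a => a ^ 2) g]
    refine Finset.sum_congr rfl fun d _ => ?_
    rw [Finset.sum_const, nsmul_eq_mul, ← quadraticChar_card_sqrts h2 d]
    congr 3
    ext; simp
  rw [squareSumCount, Nat.cast_sum, key fun d => (squareSumCount Finset.univ 1 (c - d) : ℤ)]
  simp only [squareSumCount_univ_one h2]
  have hsum := quadraticChar_sum_zero h2
  have hsub : ∑ d : F, quadraticChar F (c - d) = 0 := by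
    rw [← hsum]; exact Fintype.sum_equiv (Equiv.subLeft c) _ _ fun _ => rfl
  -- Rescaling d by c costs χ(c)^2 = 1 and leaves the Jacobi sum J(χ, χ⁻¹), as χ is its own inverse.
  have hjac : ∑ d : F, quadraticChar F d * quadraticChar F (c - d) = - quadraticChar F (-1) := by
    have h := jacobiSum_nontrivial_inv (quadraticChar_ne_one h2)
    rw [(quadraticChar_isQuadratic F).inv, jacobiSum] at h
    rw [← h]
    refine (Fintype.sum_equiv (Equiv.mulLeft₀ c hc) _ _ fun d => ?_).symm
    simp only [Equiv.mulLeft₀_apply]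
    rw [show c - c * d = c * (1 - d) by ring, map_mul, map_mul]
    have := quadraticChar_sq_one hc
    linear_combination (-(quadraticChar F d * quadraticChar F (1 - d))) * this
  have expand : ∀ d : F, (quadraticChar F d + 1) * (quadraticChar F (c - d) + 1) =
      quadraticChar F d * quadraticChar F (c - d) + quadraticChar F d + quadraticChar F (c - d)
        + 1 := fun d => by ring
  simp only [expand, Finset.sum_add_distrib, hsum, hsub, hjac]
  simp
  ring

open Classical in
/-- Removing at most one element from the coordinate range loses at most four representations. -/
theorem squareSumCount_two_univ_le (A : Finset F) (hA : Fintype.card F ≤ A.card + 1) (c : F) :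
    squareSumCount Finset.univ 2 c ≤ squareSumCount A 2 c + 4 := by
  have hAc : Aᶜ.card ≤ 1 := by rw [Finset.card_compl]; omega
  have h1 : ∀ d, squareSumCount Finset.univ 1 d
      = squareSumCount A 1 d + squareSumCount Aᶜ 1 d := by
    intro d
    simp only [squareSumCount]
    rw [Finset.sum_add_sum_compl]
  have h2 : ∑ a ∈ A, squareSumCount Aᶜ 1 (c - a ^ 2) ≤ 2 := by
    simp only [squareSumCount]
    rw [Finset.sum_comm]
    have : ∀ b ∈ Aᶜ, ∑ a ∈ A, (if c - a ^ 2 - b ^ 2 = 0 then 1 else 0) ≤ 2 := by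
      intro b _
      rw [← Finset.card_filter]
      convert card_filter_sq_eq_le A (c - b ^ 2) using 3 with a
      rw [sub_right_comm, sub_eq_zero, eq_comm]
    exact (Finset.sum_le_card_nsmul _ _ 2 this).trans (by simpa using hAc)
  have h3 : ∑ a ∈ Aᶜ, squareSumCount Finset.univ 1 (c - a ^ 2) ≤ 2 :=
    (Finset.sum_le_card_nsmul _ _ 2 fun a _ => squareSumCount_one_le _ _).trans
      (by simpa using hAc)
  have h4 : squareSumCount Finset.univ 2 c = ∑ a ∈ A, squareSumCount Finset.univ 1 (c - a ^ 2)
      + ∑ a ∈ Aᶜ, squareSumCount Finset.univ 1 (c - a ^ 2) := by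
    rw [Finset.sum_add_sum_compl]; rfl
  have h5 : ∑ a ∈ A, squareSumCount Finset.univ 1 (c - a ^ 2)
      = squareSumCount A 2 c + ∑ a ∈ A, squareSumCount Aᶜ 1 (c - a ^ 2) := by
    simp only [h1, Finset.sum_add_distrib]; rfl
  omega

/-- Squaring is bijective in characteristic 2, so the first coordinate is free and determines the
second. Here c = 0 is allowed. -/
theorem squareSumCount_univ_two_of_char_two (h2 : ringChar F = 2) (c : F) :
    squareSumCount (Finset.univ : Finset F) 2 c = Fintype.card F := by
  classical
  have : CharP F 2 := ringChar.of_eq h2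
  have h1 : ∀ d : F, squareSumCount Finset.univ 1 d = 1 := by
    intro d
    rw [squareSumCount_one, Finset.card_eq_one]
    obtain ⟨b, hb⟩ := FiniteField.isSquare_of_char_two h2 d
    refine ⟨b, ?_⟩
    ext a
    simp [hb, ← sq, sq_eq_sq_iff_eq_or_eq_neg, CharTwo.neg_eq]
  rw [squareSumCount]
  simp [h1]

theorem abs_squareSumCount_two_sub_le_of_univ (A : Finset F)
    (hA : Fintype.card F ≤ A.card + 1) {c : F}
    (h : |(squareSumCount (Finset.univ : Finset F) 2 c : ℝ) - Fintype.card F| ≤ 1) :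
    |(squareSumCount A 2 c : ℝ) - Fintype.card F| ≤ 5 := by
  have h1 : (squareSumCount Finset.univ 2 c : ℝ) ≤ squareSumCount A 2 c + 4 := by
    exact_mod_cast squareSumCount_two_univ_le A hA c
  have h2 : (squareSumCount A 2 c : ℝ) ≤ squareSumCount Finset.univ 2 c := by
    exact_mod_cast squareSumCount_mono (Finset.subset_univ A) 2 c
  rw [abs_le] at *
  constructor <;> linarith

theorem abs_squareSumCount_two_sub_le_of_char_two (A : Finset F)
    (hA : Fintype.card F ≤ A.card + 1) (h2 : ringChar F = 2) (c : F) :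
    |(squareSumCount A 2 c : ℝ) - Fintype.card F| ≤ 5 :=
  abs_squareSumCount_two_sub_le_of_univ A hA (by simp [squareSumCount_univ_two_of_char_two h2])

theorem abs_squareSumCount_two_sub_le (A : Finset F)
    (hA : Fintype.card F ≤ A.card + 1) {c : F} (hc : c ≠ 0) :
    |(squareSumCount A 2 c : ℝ) - Fintype.card F| ≤ 5 := by
  classical
  by_cases h2 : ringChar F = 2
  · exact abs_squareSumCount_two_sub_le_of_char_two A hA h2 c
  refine abs_squareSumCount_two_sub_le_of_univ A hA ?_
  have h := squareSumCount_univ_two h2 hc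
  have h' : (squareSumCount (Finset.univ : Finset F) 2 c : ℝ) - Fintype.card F
      = ((- quadraticChar F (-1) : ℤ) : ℝ) := by
    rw [show (- quadraticChar F (-1) : ℤ)
      = squareSumCount (Finset.univ : Finset F) 2 c - Fintype.card F by rw [h]; ring]
    push_cast; rfl
  rw [h']
  rcases quadraticChar_dichotomy (F := F) (a := -1) (by simp) with h | h <;> simp [h]

/-- At most one index is missing from A, so replacing |A| by the full cardinality costs at most one
extra y. -/
theorem abs_sum_sub_le {ι : Type*} [Fintype ι] {A : Finset ι}
    (hA : Fintype.card ι ≤ A.card + 1) {f : ι → ℝ}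
    {y M : ℝ} (hy : 0 ≤ y) (h : ∑ a ∈ A, |f a - y| ≤ M) :
    |∑ a ∈ A, f a - Fintype.card ι * y| ≤ M + y := by
  have h1 : ∑ a ∈ A, f a - Fintype.card ι * y
      = ∑ a ∈ A, (f a - y) - (Fintype.card ι - A.card) * y := by
    rw [Finset.sum_sub_distrib, Finset.sum_const, nsmul_eq_mul]; ring
  have h2 : (A.card : ℝ) ≤ Fintype.card ι := by exact_mod_cast Finset.card_le_univ A
  have h3 : (Fintype.card ι : ℝ) ≤ A.card + 1 := by exact_mod_cast hA
  rw [h1]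
  refine (abs_sub _ _).trans (add_le_add ((Finset.abs_sum_le_sum_abs _ _).trans h) ?_)
  rw [abs_of_nonneg (mul_nonneg (by linarith) hy)]
  nlinarith

-- The two-square estimate is unavailable only when the remaining value c - a^2 vanishes. At most
-- two a do this, each with error at most q; with 5 for each other a and q for the possibly missing
-- element, the total is at most 8q.
open Classical in
theorem abs_squareSumCount_three_sub_le (A : Finset F)
    (hA : Fintype.card F ≤ A.card + 1) (c : F) :
    |(squareSumCount A 3 c : ℝ) - (Fintype.card F : ℝ) ^ 2| ≤ 8 * Fintype.card F := by
  have hq : (1 : ℝ) ≤ Fintype.card F := by exact_mod_cast Fintype.card_pos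
  have hAle : (A.card : ℝ) ≤ Fintype.card F := by exact_mod_cast Finset.card_le_univ A
  have hterm : ∀ a ∈ A, |(squareSumCount A 2 (c - a ^ 2) : ℝ) - Fintype.card F|
      ≤ 5 + Fintype.card F * (if a ^ 2 = c then 1 else 0) := by
    intro a _
    split_ifs with h
    · have h1 : (squareSumCount A 2 (c - a ^ 2) : ℝ) ≤ 2 * Fintype.card F := by
        exact_mod_cast squareSumCount_two_le A _
      have h0 : (0 : ℝ) ≤ squareSumCount A 2 (c - a ^ 2) := by positivity
      rw [abs_le]
      constructor <;> linarith
    · simpa using abs_squareSumCount_two_sub_le A hA (sub_ne_zero.mpr (Ne.symm h))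
  have hsum : ∑ a ∈ A, |(squareSumCount A 2 (c - a ^ 2) : ℝ) - Fintype.card F|
      ≤ 7 * Fintype.card F := by
    refine (Finset.sum_le_sum hterm).trans ?_
    rw [Finset.sum_add_distrib, ← Finset.mul_sum, Finset.sum_boole, Finset.sum_const,
      nsmul_eq_mul]
    have : (({a ∈ A | a ^ 2 = c} : Finset F).card : ℝ) ≤ 2 := by
      exact_mod_cast card_filter_sq_eq_le A c
    nlinarith
  have := abs_sum_sub_le hA (f := fun a => (squareSumCount A 2 (c - a ^ 2) : ℝ))
    (by positivity) hsum
  rw [squareSumCount, Nat.cast_sum, sq]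
  linarith

/-- The number of representations as a sum of `m + 3` squares is `q ^ (m + 2)` to first order. -/
theorem abs_squareSumCount_sub_le (A : Finset F)
    (hA : Fintype.card F ≤ A.card + 1) (m : ℕ) (c : F) :
    |(squareSumCount A (m + 3) c : ℝ) - (Fintype.card F : ℝ) ^ (m + 2)|
      ≤ (m + 8) * (Fintype.card F : ℝ) ^ (m + 1) := by
  induction m generalizing c with
  | zero => simpa using abs_squareSumCount_three_sub_le A hA c
  | succ m ih =>
    have hAle : (A.card : ℝ) ≤ Fintype.card F := by exact_mod_cast Finset.card_le_univ A
    have hsum : ∑ a ∈ A, |(squareSumCount A (m + 3) (c - a ^ 2) : ℝ)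
        - (Fintype.card F : ℝ) ^ (m + 2)| ≤ (m + 8) * (Fintype.card F : ℝ) ^ (m + 2) := by
      refine (Finset.sum_le_card_nsmul _ _ _ fun a _ => ih _).trans ?_
      rw [nsmul_eq_mul]
      calc _ ≤ (Fintype.card F : ℝ) * ((m + 8) * (Fintype.card F : ℝ) ^ (m + 1)) := by gcongr
        _ = _ := by ring
    have := abs_sum_sub_le hA (f := fun a => (squareSumCount A (m + 3) (c - a ^ 2) : ℝ))
      (by positivity) hsum
    rw [show m + 1 + 3 = (m + 3) + 1 by ring, squareSumCount, Nat.cast_sum]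
    push_cast
    calc _ = |∑ a ∈ A, (squareSumCount A (m + 3) (c - a ^ 2) : ℝ)
          - Fintype.card F * (Fintype.card F : ℝ) ^ (m + 2)| := by congr 1; ring
      _ ≤ _ := this
      _ = _ := by ring

-- With i^2 = -1, each nonzero a pairs with exactly the two values ±ia.
open Classical in
theorem squareSumCount_two_zero_of_isSquare_neg_one (h2 : ringChar F ≠ 2)
    (hs : IsSquare (-1 : F)) :
    squareSumCount ((Finset.univ : Finset F).erase 0) 2 0 = 2 * (Fintype.card F - 1) := by
  have : ∀ a ∈ (Finset.univ : Finset F).erase 0,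
      squareSumCount ((Finset.univ : Finset F).erase 0) 1 (0 - a ^ 2) = 2 := by
    intro a ha
    have ha0 : a ≠ 0 := by simpa using ha
    obtain ⟨i, hi⟩ := hs
    have hi0 : i ≠ 0 := by rintro rfl; simp at hi
    rw [squareSumCount_one]
    have : ({b ∈ (Finset.univ : Finset F).erase 0 | b ^ 2 = 0 - a ^ 2} : Finset F)
        = {i * a, -(i * a)} := by
      ext b
      have h : 0 - a ^ 2 = (i * a) ^ 2 := by rw [mul_pow, sq i, ← hi]; ring
      simp only [Finset.mem_filter, Finset.mem_erase, Finset.mem_univ, h,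
        sq_eq_sq_iff_eq_or_eq_neg, Finset.mem_insert, Finset.mem_singleton, and_true]
      refine ⟨fun h => h.2, fun h => ⟨?_, h⟩⟩
      rcases h with rfl | rfl <;> simp [ha0, hi0]
    rw [this, Finset.card_pair]
    intro h
    have h' := Ring.eq_self_iff_eq_zero_of_char_ne_two h2 (a := i * a)
    simp [ha0, hi0] at h'
    exact h' h.symm
  rw [squareSumCount, Finset.sum_congr rfl this, Finset.sum_const,
    Finset.card_erase_of_mem (Finset.mem_univ _), Finset.card_univ, smul_eq_mul, mul_comm]

end Counting

/-! ### Isometries and the number of codes through an isotropic vector -/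

section Transitivity

variable {F : Type*} [Field F] {n : ℕ}

theorem le_dual_iff (C : Submodule F (Fin n → F)) :
    C ≤ dual C ↔ ∀ v ∈ C, ∀ w ∈ C, w ⬝ᵥ v = 0 := Iff.rfl

/-- The self-orthogonal codes of dimension `k` containing `v`. -/
def codesThrough (F : Type*) [Field F] (n k : ℕ) (v : Fin n → F) :
    Set (Submodule F (Fin n → F)) :=
  {C | C ∈ complementaryCodes F n k k ∧ v ∈ C}

theorem exists_isometry_apply_eq {u v : Fin n → F} (hu : u ⬝ᵥ u = 0) (hv : v ⬝ᵥ v = 0)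
    (huv : u ⬝ᵥ v ≠ 0) :
    ∃ T : (Fin n → F) →ₗ[F] (Fin n → F), (∀ x y, T x ⬝ᵥ T y = x ⬝ᵥ y) ∧ T u = v := by
  set b := u ⬝ᵥ v with hb
  have hvu : v ⬝ᵥ u = b := dotProduct_comm v u
  -- Since (u - v)·(u - v) = -2b, this is the reflection in u - v, written without dividing by 2; in
  -- characteristic 2 it is a transvection.
  refine ⟨LinearMap.id + b⁻¹ • (dotProductBilin F F (u - v)).smulRight (u - v), ?_, ?_⟩
  · intro x y
    simp only [LinearMap.add_apply, LinearMap.id_apply, LinearMap.smul_apply,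
      LinearMap.smulRight_apply, dotProductBilin, LinearMap.coe_mk, AddHom.coe_mk]
    have haa : (u - v) ⬝ᵥ (u - v) = -2 * b := by
      simp only [sub_dotProduct, dotProduct_sub, hu, hv, hvu, ← hb]; ring
    simp only [add_dotProduct, dotProduct_add, smul_dotProduct, dotProduct_smul, smul_eq_mul, haa,
      dotProduct_comm x (u - v)]
    field_simp
    ring
  · simp only [LinearMap.add_apply, LinearMap.id_apply, LinearMap.smul_apply,
      LinearMap.smulRight_apply, dotProductBilin, LinearMap.coe_mk, AddHom.coe_mk]
    rw [sub_dotProduct, hu, hvu, zero_sub, smul_smul, mul_neg, inv_mul_cancel₀ huv]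
    simp

theorem injective_of_dotProduct_eq {T : (Fin n → F) →ₗ[F] (Fin n → F)}
    (hT : ∀ x y, T x ⬝ᵥ T y = x ⬝ᵥ y) : Function.Injective T := by
  rw [← LinearMap.ker_eq_bot, LinearMap.ker_eq_bot']
  intro x hx
  refine dotProduct_eq_zero x fun y => ?_
  rw [← hT, hx, zero_dotProduct]

theorem ncard_codesThrough_le [Finite F] (k : ℕ) {u v : Fin n → F} (hu : u ⬝ᵥ u = 0)
    (hv : v ⬝ᵥ v = 0) (huv : u ⬝ᵥ v ≠ 0) :
    (codesThrough F n k u).ncard ≤ (codesThrough F n k v).ncard := by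
  obtain ⟨T, hT, hTu⟩ := exists_isometry_apply_eq hu hv huv
  have hinj := injective_of_dotProduct_eq hT
  refine Set.ncard_le_ncard_of_injOn (Submodule.map T) ?_
    ((Submodule.map_injective_of_injective hinj).injOn) (Set.toFinite _)
  rintro C ⟨hC, hCu⟩
  rw [mem_complementaryCodes_self, le_dual_iff] at hC
  refine ⟨?_, ⟨u, hCu, hTu⟩⟩
  rw [mem_complementaryCodes_self, le_dual_iff]
  refine ⟨(Submodule.equivMapOfInjective T hinj C).finrank_eq.symm.trans hC.1, ?_⟩
  rintro _ ⟨x, hx, rfl⟩ _ ⟨y, hy, rfl⟩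
  rw [hT]
  exact hC.2 x hx y hy

theorem ncard_codesThrough_eq_of_dotProduct_ne [Finite F] (k : ℕ) {u v : Fin n → F}
    (hu : u ⬝ᵥ u = 0) (hv : v ⬝ᵥ v = 0) (huv : u ⬝ᵥ v ≠ 0) :
    (codesThrough F n k u).ncard = (codesThrough F n k v).ncard :=
  (ncard_codesThrough_le k hu hv huv).antisymm
    (ncard_codesThrough_le k hv hu (by rwa [dotProduct_comm]))

/-- Two vectors that each fail to be orthogonal to a subspace have a common non-orthogonal vector
in it. -/
theorem exists_mem_dotProduct_ne (W : Submodule F (Fin n → F)) {u v : Fin n → F}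
    (hu : ∃ x ∈ W, u ⬝ᵥ x ≠ 0) (hv : ∃ x ∈ W, v ⬝ᵥ x ≠ 0) :
    ∃ x ∈ W, u ⬝ᵥ x ≠ 0 ∧ v ⬝ᵥ x ≠ 0 := by
  obtain ⟨x, hxW, hx⟩ := hu
  obtain ⟨y, hyW, hy⟩ := hv
  by_cases h1 : v ⬝ᵥ x = 0
  · by_cases h2 : u ⬝ᵥ y = 0
    · exact ⟨x + y, W.add_mem hxW hyW, by simp [dotProduct_add, h2, hx],
        by simp [dotProduct_add, h1, hy]⟩
    · exact ⟨y, hyW, h2, hy⟩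
  · exact ⟨x, hxW, hx, h1⟩

theorem exists_dotProduct_ne {u : Fin n → F} (hu : u ≠ 0) : ∃ x, u ⬝ᵥ x ≠ 0 := by
  by_contra! h
  exact hu (dotProduct_eq_zero u h)

theorem ncard_codesThrough_eq_of_two_ne_zero [Finite F] (h2 : (2 : F) ≠ 0) (k : ℕ)
    {u v : Fin n → F} (hu : u ⬝ᵥ u = 0) (hv : v ⬝ᵥ v = 0) (hu0 : u ≠ 0) (hv0 : v ≠ 0) :
    (codesThrough F n k u).ncard = (codesThrough F n k v).ncard := by
  by_cases huv : u ⬝ᵥ v = 0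
  · obtain ⟨x, -, hux, hvx⟩ := exists_mem_dotProduct_ne (⊤ : Submodule F (Fin n → F))
      ((exists_dotProduct_ne hu0).imp fun _ h => ⟨trivial, h⟩)
      ((exists_dotProduct_ne hv0).imp fun _ h => ⟨trivial, h⟩)
    -- The multiple of u makes w isotropic; as u is orthogonal to u and v, it leaves both products
    -- with x unchanged.
    set w := x - ((x ⬝ᵥ x) / (2 * (u ⬝ᵥ x))) • u with hw
    have huw : u ⬝ᵥ w = u ⬝ᵥ x := by simp [hw, dotProduct_sub, hu]
    have hvw : v ⬝ᵥ w = v ⬝ᵥ x := by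
      simp [hw, dotProduct_sub, dotProduct_comm v u, huv]
    have hww : w ⬝ᵥ w = 0 := by
      simp only [hw, dotProduct_sub, sub_dotProduct, dotProduct_smul, smul_dotProduct,
        smul_eq_mul, hu, dotProduct_comm x u]
      field_simp
      ring
    exact (ncard_codesThrough_eq_of_dotProduct_ne k hu hww (huw ▸ hux)).trans
      (ncard_codesThrough_eq_of_dotProduct_ne k hv hww (hvw ▸ hvx)).symm
  · exact ncard_codesThrough_eq_of_dotProduct_ne k hu hv huv

theorem dotProduct_self_eq_zero_iff_of_char_two [CharP F 2] (x : Fin n → F) :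
    x ⬝ᵥ x = 0 ↔ ∑ i, x i = 0 := by
  have : x ⬝ᵥ x = (∑ i, x i) ^ 2 := by
    rw [CharTwo.sum_sq]; simp [dotProduct, sq]
  rw [this, sq_eq_zero_iff]

/-- Differences of standard basis vectors have coordinate sum zero; a vector orthogonal to all of
them is constant. -/
theorem exists_isotropic_dotProduct_ne_of_char_two [CharP F 2] {u : Fin n → F}
    (hu : u ∉ Submodule.span F {(1 : Fin n → F)}) :
    ∃ x, ∑ i, x i = 0 ∧ u ⬝ᵥ x ≠ 0 := by
  by_contra! h
  have hconst : ∀ i l, u i = u l := by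
    intro i l
    have := h (Pi.single i 1 - Pi.single l 1) (by simp [Finset.sum_sub_distrib])
    simpa [dotProduct_sub, sub_eq_zero] using this
  apply hu
  rw [Submodule.mem_span_singleton]
  rcases isEmpty_or_nonempty (Fin n) with he | ⟨⟨i⟩⟩
  · exact ⟨0, Subsingleton.elim _ _⟩
  · exact ⟨u i, funext fun l => by simp [hconst i l]⟩

/-- The isotropic vectors form the hyperplane W of coordinate sum zero, so the auxiliary vector is
sought inside W. Multiples of the all-one vector are orthogonal to W and must be excluded. -/
theorem ncard_codesThrough_eq_of_char_two [Finite F] [CharP F 2] (k : ℕ)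
    {u v : Fin n → F} (hu : u ⬝ᵥ u = 0) (hv : v ⬝ᵥ v = 0)
    (hu1 : u ∉ Submodule.span F {(1 : Fin n → F)})
    (hv1 : v ∉ Submodule.span F {(1 : Fin n → F)}) :
    (codesThrough F n k u).ncard = (codesThrough F n k v).ncard := by
  let W : Submodule F (Fin n → F) := LinearMap.ker (dotProductBilin F F (1 : Fin n → F))
  have hW : ∀ x, x ∈ W ↔ ∑ i, x i = 0 := fun x => by simp [W, dotProductBilin, dotProduct]
  obtain ⟨w, hwW, huw, hvw⟩ := exists_mem_dotProduct_ne W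
    ((exists_isotropic_dotProduct_ne_of_char_two hu1).imp fun x h => ⟨(hW x).mpr h.1, h.2⟩)
    ((exists_isotropic_dotProduct_ne_of_char_two hv1).imp fun x h => ⟨(hW x).mpr h.1, h.2⟩)
  have hww : w ⬝ᵥ w = 0 := (dotProduct_self_eq_zero_iff_of_char_two w).mpr ((hW w).mp hwW)
  exact (ncard_codesThrough_eq_of_dotProduct_ne k hu hww huw).trans
    (ncard_codesThrough_eq_of_dotProduct_ne k hv hww hvw).symm

/-- A nonzero isotropic vector lies on exactly one self-orthogonal code of dimension one. -/
theorem ncard_codesThrough_one {u : Fin n → F} (hu : u ⬝ᵥ u = 0) (hu0 : u ≠ 0) :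
    (codesThrough F n 1 u).ncard = 1 := by
  rw [Set.ncard_eq_one]
  refine ⟨Submodule.span F {u}, Set.eq_singleton_iff_unique_mem.mpr ⟨⟨?_, ?_⟩, ?_⟩⟩
  · rw [mem_complementaryCodes_self, le_dual_iff]
    refine ⟨finrank_span_singleton hu0, ?_⟩
    intro v hv w hw
    obtain ⟨a, rfl⟩ := Submodule.mem_span_singleton.mp hv
    obtain ⟨b, rfl⟩ := Submodule.mem_span_singleton.mp hw
    simp [hu]
  · exact Submodule.mem_span_singleton_self u
  · rintro C ⟨hC, huC⟩
    have h1 := ((mem_complementaryCodes_self C).mp hC).1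
    refine (Submodule.eq_of_le_of_finrank_le ?_ ?_).symm
    · simpa using huC
    · rw [h1, finrank_span_singleton hu0]

/-- A self-orthogonal code has dimension at most half its length. -/
theorem two_mul_finrank_le_of_le_dual {C : Submodule F (Fin n → F)} (h : C ≤ dual C) :
    2 * Module.finrank F C ≤ n := by
  have hnd : (dotProductBilin F F : LinearMap.BilinForm F (Fin n → F)).Nondegenerate :=
    ⟨fun x hx => dotProduct_eq_zero x hx,
      fun x hx => dotProduct_eq_zero x fun y => (dotProduct_comm x y).trans (hx y)⟩
  have h1 := LinearMap.BilinForm.finrank_orthogonal hnd C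
  have h2 := Submodule.finrank_mono h
  have h3 := Submodule.finrank_le C
  rw [dual, h1] at h2
  rw [Module.finrank_fin_fun] at h2 h3
  omega

theorem exists_le_finrank_eq (C : Submodule F (Fin n → F)) {k : ℕ}
    (h : k ≤ Module.finrank F C) : ∃ D ≤ C, Module.finrank F D = k := by
  let b := Module.finBasis F C
  let w : Fin k → (Fin n → F) := fun i => b (Fin.castLE h i)
  have hw : LinearIndependent F w :=
    (b.linearIndependent.map' C.subtype C.ker_subtype).comp (Fin.castLE h)
      (Fin.castLE_injective h)
  refine ⟨Submodule.span F (Set.range w), Submodule.span_le.mpr ?_, ?_⟩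
  · rintro _ ⟨i, rfl⟩
    exact (b (Fin.castLE h i)).2
  · rw [finrank_span_eq_card hw, Fintype.card_fin]

theorem nonempty_complementaryCodes_of_le_wittIndex {k : ℕ} (h : k ≤ wittIndex F n) :
    (complementaryCodes F n k k).Nonempty := by
  -- Boundedness is what makes the natural-number `sSup` an attained maximum.
  have hbdd : BddAbove {k | ∃ C : Submodule F (Fin n → F), C ≤ dual C ∧
      Module.finrank F C = k} := by
    refine ⟨n, ?_⟩
    rintro _ ⟨C, -, rfl⟩
    simpa using Submodule.finrank_le C
  have hne : {k | ∃ C : Submodule F (Fin n → F), C ≤ dual C ∧ Module.finrank F C = k}.Nonempty :=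
    ⟨0, ⊥, bot_le, finrank_bot F _⟩
  obtain ⟨C, hC, hCk⟩ := Nat.sSup_mem hne hbdd
  change _ = wittIndex F n at hCk
  obtain ⟨D, hDC, hD⟩ := exists_le_finrank_eq C (h.trans_eq hCk.symm)
  exact ⟨D, (mem_complementaryCodes_self D).mpr ⟨hD, (le_dual_iff D).mpr fun v hv w hw =>
    (le_dual_iff C).mp hC v (hDC hv) w (hDC hw)⟩⟩

theorem two_mul_le_of_le_wittIndex {k : ℕ} (h : k ≤ wittIndex F n) : 2 * k ≤ n := by
  obtain ⟨C, hC⟩ := nonempty_complementaryCodes_of_le_wittIndex h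
  obtain ⟨rfl, h2⟩ := (mem_complementaryCodes_self C).mp hC
  exact two_mul_finrank_le_of_le_dual h2

end Transitivity

/-! ### Double counting and the average weight -/

section Averages

variable {F : Type*} [Field F] {n : ℕ}

theorem hammingNorm_eq_of_mem_span_one [DecidableEq F] {v : Fin n → F} (hv0 : v ≠ 0)
    (hv : v ∈ Submodule.span F {(1 : Fin n → F)}) : hammingNorm v = n := by
  obtain ⟨c, rfl⟩ := Submodule.mem_span_singleton.mp hv
  have hc : c ≠ 0 := by rintro rfl; simp at hv0
  simp [hammingNorm, hc]

theorem sum_support_sq [DecidableEq F] (v : Fin n → F) :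
    ∑ i ∈ Finset.univ.filter (fun i => v i ≠ 0), v i ^ 2 = v ⬝ᵥ v := by
  rw [dotProduct, Finset.sum_filter]
  refine Finset.sum_congr rfl fun i _ => ?_
  split_ifs with h
  · ring
  · push Not at h
    simp [h]

variable [Fintype F]

open Classical in
/-- The nonzero isotropic vectors of `Fⁿ`. -/
noncomputable def isotropicVectors (F : Type*) [Field F] [Fintype F] (n : ℕ) :
    Finset (Fin n → F) :=
  {v | v ⬝ᵥ v = 0 ∧ v ≠ 0}

theorem mem_isotropicVectors {v : Fin n → F} :
    v ∈ isotropicVectors F n ↔ v ⬝ᵥ v = 0 ∧ v ≠ 0 := by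
  simp only [isotropicVectors, Finset.mem_filter, Finset.mem_univ, true_and]

open Classical in
/-- The isotropic vectors of Hamming weight `j`. -/
noncomputable def isotropicOfWeight (F : Type*) [Field F] [Fintype F] (n j : ℕ) :
    Finset (Fin n → F) :=
  {v | v ⬝ᵥ v = 0 ∧ hammingNorm v = j}

open Classical in
theorem sum_ncard_codesThrough (k : ℕ) (V : Finset (Fin n → F)) :
    ∑ v ∈ V, (codesThrough F n k v).ncard
      = ∑ C ∈ (complementaryCodes F n k k).toFinset, ({v ∈ V | v ∈ C} : Finset _).card := by
  have h := Finset.sum_card_bipartiteAbove_eq_sum_card_bipartiteBelow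
    (s := V) (t := (complementaryCodes F n k k).toFinset) (fun v C => v ∈ C)
  simp only [Finset.bipartiteAbove, Finset.bipartiteBelow] at h
  rw [← h]
  refine Finset.sum_congr rfl fun v _ => ?_
  rw [Set.ncard_eq_toFinset_card']
  congr 1
  ext C
  rw [Set.mem_toFinset, Finset.mem_filter, Set.mem_toFinset]
  rfl

/-- All q^k - 1 nonzero vectors of a self-orthogonal code are isotropic. -/
theorem sum_isotropic_ncard_codesThrough (k : ℕ) :
    ∑ v ∈ isotropicVectors F n, (codesThrough F n k v).ncard
      = (complementaryCodes F n k k).ncard * (Fintype.card F ^ k - 1) := by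
  classical
  rw [sum_ncard_codesThrough, Finset.sum_congr rfl (g := fun _ => Fintype.card F ^ k - 1),
    Finset.sum_const, smul_eq_mul, Set.ncard_eq_toFinset_card']
  intro C hC
  obtain ⟨h1, h2⟩ := (mem_complementaryCodes_self C).mp (Set.mem_toFinset.mp hC)
  have : ({v ∈ isotropicVectors F n | v ∈ C} : Finset _)
      = (Finset.univ.filter fun v : Fin n → F => v ∈ C).erase 0 := by
    ext v
    simp only [isotropicVectors, Finset.mem_filter, Finset.mem_univ, true_and, Finset.mem_erase]
    exact ⟨fun h => ⟨h.1.2, h.2⟩, fun h => ⟨⟨(le_dual_iff C).mp h2 v h.2 v h.2, h.1⟩, h.2⟩⟩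
  rw [this, Finset.card_erase_of_mem (by simp), ← h1, ← Module.card_eq_pow_finrank,
    Fintype.card_subtype]

theorem aggregateWeight_eq_sum (k j : ℕ) :
    aggregateWeight F n k k j
      = ∑ v ∈ isotropicOfWeight F n j, (codesThrough F n k v).ncard := by
  classical
  rw [sum_ncard_codesThrough, aggregateWeight, finsum_mem_eq_toFinset_sum]
  refine Finset.sum_congr rfl fun C hC => ?_
  obtain ⟨h1, h2⟩ := (mem_complementaryCodes_self C).mp (Set.mem_toFinset.mp hC)
  rw [weightCount, Set.ncard_eq_toFinset_card']
  congr 1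
  ext v
  simp only [isotropicOfWeight, Finset.mem_filter, Finset.mem_univ, true_and, Set.mem_toFinset,
    Set.mem_ofPred_eq]
  exact ⟨fun h => ⟨⟨(le_dual_iff C).mp h2 v h.1 v h.1, by rw [← h.2]⟩, h.1⟩,
    fun h => ⟨h.2, by rw [← h.1.2]⟩⟩

theorem isotropicOfWeight_subset {j : ℕ} (hj : 1 ≤ j) :
    isotropicOfWeight F n j ⊆ isotropicVectors F n := by
  classical
  intro v hv
  simp only [isotropicOfWeight, isotropicVectors, Finset.mem_filter, Finset.mem_univ,
    true_and] at hv ⊢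
  refine ⟨hv.1, ?_⟩
  rintro rfl
  have := hv.2
  simp at this
  omega

open Classical in
/-- The average weight when all isotropic vectors outside `E` lie on equally many codes. -/
theorem averageWeight_mul_card {k j : ℕ} (hj : 1 ≤ j) (E : Finset (Fin n → F))
    (hE : ∀ u ∈ isotropicVectors F n \ E, ∀ v ∈ isotropicVectors F n \ E,
      (codesThrough F n k u).ncard = (codesThrough F n k v).ncard)
    (hN : (complementaryCodes F n k k).Nonempty) :
    averageWeight F n k k j * ((isotropicVectors F n \ E).card : ℝ)
      = ((isotropicOfWeight F n j \ E).card : ℝ) * ((Fintype.card F : ℝ) ^ k - 1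
        - (∑ v ∈ isotropicVectors F n ∩ E, (codesThrough F n k v).ncard : ℕ)
          / ((complementaryCodes F n k k).ncard : ℝ))
        + (∑ v ∈ isotropicOfWeight F n j ∩ E, (codesThrough F n k v).ncard : ℕ)
          / ((complementaryCodes F n k k).ncard : ℝ) * ((isotropicVectors F n \ E).card : ℝ) := by
  have hsub := Finset.sdiff_subset_sdiff (isotropicOfWeight_subset (F := F) (n := n) hj)
    (Finset.Subset.refl E)
  have hN0 : ((complementaryCodes F n k k).ncard : ℝ) ≠ 0 := by
    exact_mod_cast (Set.ncard_ne_zero_of_mem hN.some_mem)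
  have hsum : ∃ b : ℕ, ∀ v ∈ isotropicVectors F n \ E, (codesThrough F n k v).ncard = b := by
    rcases (isotropicVectors F n \ E).eq_empty_or_nonempty with h | ⟨u, hu⟩
    · exact ⟨0, by simp [h]⟩
    · exact ⟨_, fun v hv => hE v hv u hu⟩
  obtain ⟨b, hb⟩ := hsum
  have h1 := sum_isotropic_ncard_codesThrough (F := F) (n := n) k
  rw [← Finset.sum_inter_add_sum_sdiff _ E, Finset.sum_congr rfl hb, Finset.sum_const,
    smul_eq_mul] at h1
  have h2 := aggregateWeight_eq_sum (F := F) (n := n) k j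
  rw [← Finset.sum_inter_add_sum_sdiff _ E, Finset.sum_congr rfl (fun v hv => hb v (hsub hv)),
    Finset.sum_const, smul_eq_mul] at h2
  have hq : 1 ≤ Fintype.card F ^ k := Nat.one_le_pow _ _ Fintype.card_pos
  have h1' := congrArg (Nat.cast : ℕ → ℝ) h1
  rw [Nat.cast_add, Nat.cast_mul, Nat.cast_mul, Nat.cast_sub hq, Nat.cast_pow, Nat.cast_one] at h1'
  rw [averageWeight, h2, Nat.cast_add, Nat.cast_mul]
  field_simp
  linear_combination ((isotropicOfWeight F n j \ E).card : ℝ) * h1'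

open Classical in
theorem card_filter_span_one_le :
    (Finset.univ.filter fun v : Fin n → F => v ∈ Submodule.span F {(1 : Fin n → F)}).card
      ≤ Fintype.card F := by
  rw [← Finset.card_univ]
  refine Finset.card_le_card_of_surjOn (fun c : F => c • (1 : Fin n → F)) ?_
  intro v hv
  simp only [Finset.coe_filter, Finset.mem_univ, true_and, Set.mem_ofPred_eq,
    Submodule.mem_span_singleton] at hv
  simpa using hv

theorem sum_ncard_codesThrough_le {k : ℕ} (V : Finset (Fin n → F)) :
    ∑ v ∈ V, (codesThrough F n k v).ncard ≤ V.card * (complementaryCodes F n k k).ncard := by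
  rw [← smul_eq_mul]
  exact Finset.sum_le_card_nsmul _ _ _ fun v _ =>
    Set.ncard_le_ncard (fun C hC => hC.1) (Set.toFinite _)

/-- The average weight in terms of the numbers of isotropic vectors, up to lower order terms. -/
theorem exists_averageWeight_mul_eq {k j : ℕ} (hk : 1 ≤ k) (hj : 2 ≤ j) (hn : 3 ≤ n)
    (hN : (complementaryCodes F n k k).Nonempty) :
    ∃ a b r m : ℝ, |a| ≤ (Fintype.card F : ℝ) ^ (k - 1) ∧
      |b| ≤ (Fintype.card F : ℝ) ^ ((j : ℤ) - n + k - 1) ∧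
      |r - (isotropicOfWeight F n j).card| ≤ (Fintype.card F : ℝ) ^ (j - 2) ∧
      |m - (isotropicVectors F n).card| ≤ (Fintype.card F : ℝ) ^ (n - 2) ∧
      averageWeight F n k k j * m = r * ((Fintype.card F : ℝ) ^ k - 1 - a) + b * m := by
  classical
  -- Here no vector is exceptional. Otherwise k ≥ 2, which is what lets q be bounded by q^(k-1).
  by_cases hcase : (2 : F) ≠ 0 ∨ k = 1
  · have h := averageWeight_mul_card (F := F) (n := n) (k := k) (j := j) (by omega) ∅ ?_ hN
    · refine ⟨_, _, _, _, ?_, ?_, ?_, ?_, h⟩ <;> simp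
      positivity
    · intro u hu v hv
      simp only [Finset.sdiff_empty, isotropicVectors, Finset.mem_filter, Finset.mem_univ,
        true_and] at hu hv
      rcases hcase with h2 | rfl
      · exact ncard_codesThrough_eq_of_two_ne_zero h2 k hu.1 hv.1 hu.2 hv.2
      · rw [ncard_codesThrough_one hu.1 hu.2, ncard_codesThrough_one hv.1 hv.2]
  · push Not at hcase
    obtain ⟨h2, hk1⟩ := hcase
    have : CharP F 2 := CharTwo.of_one_ne_zero_of_two_eq_zero one_ne_zero h2
    have hq : (1 : ℝ) ≤ Fintype.card F := by exact_mod_cast Fintype.card_pos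
    have hpow : ∀ l : ℕ, 1 ≤ l → (Fintype.card F : ℝ) ≤ (Fintype.card F : ℝ) ^ l := fun l hl =>
      le_self_pow₀ hq (by omega)
    have hN0 : (0 : ℝ) < (complementaryCodes F n k k).ncard := by
      exact_mod_cast (Set.ncard_pos (Set.toFinite _)).mpr hN
    set E := (Finset.univ.filter fun v : Fin n → F => v ∈ Submodule.span F {(1 : Fin n → F)})
      with hEdef
    have hbound : ∀ V : Finset (Fin n → F),
        |(∑ v ∈ V ∩ E, (codesThrough F n k v).ncard : ℕ)
          / ((complementaryCodes F n k k).ncard : ℝ)| ≤ Fintype.card F := by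
      intro V
      rw [abs_of_nonneg (by positivity), div_le_iff₀ hN0]
      exact_mod_cast (sum_ncard_codesThrough_le (V ∩ E)).trans (Nat.mul_le_mul_right _
        ((Finset.card_le_card Finset.inter_subset_right).trans card_filter_span_one_le))
    have hdiff : ∀ V : Finset (Fin n → F),
        |((V \ E).card : ℝ) - V.card| ≤ Fintype.card F := by
      intro V
      have h : ((V ∩ E).card : ℝ) ≤ Fintype.card F := by
        exact_mod_cast (Finset.card_le_card Finset.inter_subset_right).trans
          card_filter_span_one_le
      rw [← Finset.card_sdiff_add_card_inter V E]
      push_cast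
      rw [sub_add_cancel_left, abs_neg, abs_of_nonneg (by positivity)]
      exact h
    have hempty : j ≠ n → isotropicOfWeight F n j ∩ E = ∅ := by
      intro hne
      rw [Finset.eq_empty_iff_forall_notMem]
      intro v hv
      rw [Finset.mem_inter] at hv
      have hv0 := isotropicOfWeight_subset (by omega) hv.1
      simp only [isotropicOfWeight, isotropicVectors, hEdef, Finset.mem_filter, Finset.mem_univ,
        true_and] at hv hv0
      refine hne ?_
      rw [← hammingNorm_eq_of_mem_span_one hv0.2 hv.2, ← hv.1.2]
    refine ⟨_, _, _, _, (hbound _).trans (hpow _ (by omega)), ?_, ?_,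
      (hdiff _).trans (hpow _ (by omega)),
      averageWeight_mul_card (F := F) (n := n) (k := k) (j := j) (by omega) E ?_ hN⟩
    -- Nonzero multiples of the all-one vector have weight n, so they contribute to weight j only if
    -- j = n.
    · by_cases hjn' : j = n
      · refine (hbound _).trans ?_
        rw [hjn', show (n : ℤ) - n + k - 1 = ((k - 1 : ℕ) : ℤ) by omega, zpow_natCast]
        exact hpow _ (by omega)
      · rw [hempty hjn']
        simp
        positivity
    · by_cases hjn' : j = n
      · exact (hdiff _).trans (hpow _ (by omega))
      · rw [← Finset.sdiff_inter_self_left, hempty hjn']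
        simp
    · intro u hu v hv
      simp only [isotropicVectors, hEdef, Finset.mem_sdiff, Finset.mem_filter, Finset.mem_univ,
        true_and] at hu hv
      exact ncard_codesThrough_eq_of_char_two k hu.1.1 hv.1.1 hu.2 hv.2

open Classical in
theorem card_isotropicOfWeight (j : ℕ) :
    (isotropicOfWeight F n j).card
      = n.choose j * squareSumCount ((Finset.univ : Finset F).erase 0) j 0 := by
  rw [Finset.card_eq_sum_card_fiberwise
    (f := fun v => Finset.univ.filter fun i => v i ≠ 0) (t := Finset.powersetCard j Finset.univ)]
  · rw [Finset.sum_congr rfl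
      (g := fun _ => squareSumCount ((Finset.univ : Finset F).erase 0) j 0), Finset.sum_const,
      Finset.card_powersetCard, Finset.card_univ, Fintype.card_fin, smul_eq_mul]
    intro s hs
    rw [Finset.mem_powersetCard_univ] at hs
    rw [← hs, ← card_supported_squareSum]
    congr 1
    ext v
    simp only [isotropicOfWeight, Finset.mem_filter, Finset.mem_univ, true_and,
      Finset.mem_erase, and_true]
    constructor
    · rintro ⟨⟨h1, h2⟩, rfl⟩
      exact ⟨by simp, by simp, (sum_support_sq v).trans h1⟩
    · rintro ⟨h1, h2, h3⟩
      have hsupp : (Finset.univ.filter fun i => v i ≠ 0) = s := by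
        ext i
        by_cases hi : i ∈ s
        · simp [hi, h1 i hi]
        · simp [hi, h2 i hi]
      refine ⟨⟨?_, ?_⟩, hsupp⟩
      · rw [← sum_support_sq, hsupp, h3]
      · rw [← hsupp]; simp [hammingNorm]
  · intro v hv
    simp only [isotropicOfWeight, Finset.coe_filter, Finset.mem_univ, true_and,
      Set.mem_ofPred_eq] at hv
    simp only [Finset.mem_coe, Finset.mem_powersetCard_univ]
    rw [← hv.2]; simp [hammingNorm]

theorem card_isotropicVectors :
    (isotropicVectors F n).card + 1 = squareSumCount (Finset.univ : Finset F) n 0 := by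
  classical
  have h := card_supported_squareSum (ι := Fin n) (Finset.univ : Finset F) Finset.univ 0
  rw [Finset.card_univ, Fintype.card_fin] at h
  rw [← h]
  have : isotropicVectors F n = Finset.erase
    ({x : Fin n → F | (∀ i ∈ Finset.univ, x i ∈ Finset.univ) ∧ (∀ i ∉ Finset.univ, x i = 0) ∧
      ∑ i, x i ^ 2 = 0} : Finset (Fin n → F)) 0 := by
    ext v
    rw [mem_isotropicVectors]
    simp [dotProduct, sq, and_comm]
  rw [this, Finset.card_erase_add_one (by simp)]
  congr!

end Averages

/-! ### Passage to the limit -/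

section Asymptotics

theorem tendsto_of_abs_sub_le_div {S : Set ℕ} {f : ℕ → ℝ} {y K : ℝ}
    (h : ∀ q ∈ S, |f q - y| ≤ K / q) : Tendsto f (atTop ⊓ 𝓟 S) (𝓝 y) := by
  rw [tendsto_iff_norm_sub_tendsto_zero]
  refine squeeze_zero' (Eventually.of_forall fun _ => norm_nonneg _)
    (mem_of_superset (mem_inf_of_right (mem_principal_self S)) fun q hq => h q hq)
    ((tendsto_const_div_atTop_nhds_zero_nat K).mono_left inf_le_left)

/-- Each of a, b, r, m, divided by its natural power of q, converges with error O(1/q), and f is a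
rational expression in them. The set S may be finite, the limit being then vacuous. -/
theorem asympOn_of_mul_eq {S : Set ℕ} {f : ℕ → ℝ} {n j k : ℕ} {c K : ℝ} (hc : 0 < c)
    (hn : 2 ≤ n) (hj : 2 ≤ j) (hk : 1 ≤ k)
    (h : ∀ q ∈ S, 1 ≤ q ∧ ∃ a b r m : ℝ, |a| ≤ (q : ℝ) ^ (k - 1) ∧
      |b| ≤ (q : ℝ) ^ ((j : ℤ) - n + k - 1) ∧
      |r - c * (q : ℝ) ^ (j - 1)| ≤ K * (q : ℝ) ^ (j - 2) ∧
      |m - (q : ℝ) ^ (n - 1)| ≤ K * (q : ℝ) ^ (n - 2) ∧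
      f q * m = r * ((q : ℝ) ^ k - 1 - a) + b * m) :
    AsympOn S f (fun q => c * (q : ℝ) ^ ((j : ℤ) - n + k)) := by
  choose! hq a b r m ha hb hr hm heq using h
  obtain ⟨n, rfl⟩ := Nat.exists_eq_add_of_le' hn
  obtain ⟨j, rfl⟩ := Nat.exists_eq_add_of_le' hj
  obtain ⟨k, rfl⟩ := Nat.exists_eq_add_of_le' hk
  simp only [Nat.add_sub_cancel, show j + 2 - 1 = j + 1 by omega,
    show n + 2 - 1 = n + 1 by omega] at ha hr hm
  have hq0 : ∀ q ∈ S, (0 : ℝ) < q := fun q h => by exact_mod_cast hq q h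
  have hA : Tendsto (fun q => a q / (q : ℝ) ^ (k + 1)) (atTop ⊓ 𝓟 S) (𝓝 0) := by
    refine tendsto_of_abs_sub_le_div (K := 1) fun q hqS => ?_
    have h0 := hq0 q hqS
    rw [sub_zero, abs_div, abs_of_pos (by positivity : (0 : ℝ) < (q : ℝ) ^ (k + 1)),
      div_le_div_iff₀ (by positivity) h0, pow_succ, one_mul]
    exact mul_le_mul_of_nonneg_right (ha q hqS) h0.le
  have hB : Tendsto (fun q => b q / (q : ℝ) ^ (((j + 2 : ℕ) : ℤ) - (n + 2 : ℕ) + (k + 1 : ℕ)))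
      (atTop ⊓ 𝓟 S) (𝓝 0) := by
    refine tendsto_of_abs_sub_le_div (K := 1) fun q hqS => ?_
    have h0 := hq0 q hqS
    have h1 := hb q hqS
    rw [zpow_sub_one₀ h0.ne'] at h1
    rw [sub_zero, abs_div, abs_of_pos (zpow_pos h0 _), div_le_iff₀ (zpow_pos h0 _), one_div,
      mul_comm]
    exact h1
  have hpow : ∀ (l : ℕ) (g : ℕ → ℝ) (y : ℝ),
      (∀ q ∈ S, |g q - y * (q : ℝ) ^ (l + 1)| ≤ K * (q : ℝ) ^ l) →
      Tendsto (fun q => g q / (q : ℝ) ^ (l + 1)) (atTop ⊓ 𝓟 S) (𝓝 y) := by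
    intro l g y hg
    refine tendsto_of_abs_sub_le_div (K := K) fun q hqS => ?_
    have h0 := hq0 q hqS
    rw [div_sub' (by positivity), abs_div,
      abs_of_pos (by positivity : (0 : ℝ) < (q : ℝ) ^ (l + 1)),
      div_le_div_iff₀ (by positivity) h0, pow_succ, ← mul_assoc]
    refine mul_le_mul_of_nonneg_right ?_ h0.le
    have := hg q hqS
    rwa [mul_comm y, pow_succ] at this
  have hR := hpow j r c hr
  have hM := hpow n m 1 fun q hqS => by rw [one_mul]; exact hm q hqS
  have hU : Tendsto (fun q : ℕ => 1 / (q : ℝ) ^ (k + 1)) (atTop ⊓ 𝓟 S) (𝓝 0) := by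
    refine tendsto_of_abs_sub_le_div (K := 1) fun q hqS => ?_
    have h0 := hq0 q hqS
    have h1 : (1 : ℝ) ≤ q := by exact_mod_cast hq q hqS
    rw [sub_zero, abs_of_pos (by positivity)]
    exact one_div_le_one_div_of_le h0 (le_self_pow₀ h1 (by omega))
  have hlim := (((hR.mul ((hU.const_sub 1).sub hA)).add (hB.mul hM)).div hM one_ne_zero).div_const c
  have hone : (c * (1 - 0 - 0) + 0 * 1) / 1 / c = 1 := by field_simp; ring
  rw [hone] at hlim
  refine hlim.congr' ?_
  filter_upwards [hM.eventually_ne one_ne_zero,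
    mem_inf_of_right (f := atTop) (mem_principal_self S)] with q hM0 hqS
  have h0 := (hq0 q hqS).ne'
  have hm0 : m q ≠ 0 := by rintro h; simp [h] at hM0
  have hf : f q = (r q * ((q : ℝ) ^ (k + 1) - 1 - a q) + b q * m q) / m q := by
    rw [← heq q hqS, mul_div_cancel_right₀ _ hm0]
  have hz : (q : ℝ) ^ (((j + 2 : ℕ) : ℤ) - (n + 2 : ℕ) + (k + 1 : ℕ))
      = (q : ℝ) ^ (j + 1) * (q : ℝ) ^ (k + 1) / (q : ℝ) ^ (n + 1) := by
    rw [eq_div_iff (by positivity), ← zpow_natCast, ← zpow_natCast, ← zpow_natCast,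
      ← zpow_add₀ h0, ← zpow_add₀ h0]
    congr 1
    push_cast
    ring
  simp only [Pi.div_apply]
  rw [hf, hz]
  field_simp

variable {F : ℕ → Type*} [∀ q, Field (F q)]

open Classical in
theorem asympOn_averageWeight (hF : ∀ q, IsPrimePow q → Nat.card (F q) = q)
    {n j k : ℕ} (hn : 3 ≤ n) (hj : 2 ≤ j) (hjn : j ≤ n) (hk : 1 ≤ k) {S : Set ℕ}
    (hS : ∀ q ∈ S, IsPrimePow q ∧ k ≤ wittIndex (F q) n) {c : ℝ} (hc : 0 < c)
    (hcount : ∀ q ∈ S, ∀ _ : Fintype (F q), Fintype.card (F q) = q →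
      |(squareSumCount ((Finset.univ : Finset (F q)).erase 0) j 0 : ℝ) - c * (q : ℝ) ^ (j - 1)|
        ≤ (j + 5) * (q : ℝ) ^ (j - 2)) :
    AsympOn S (fun q => averageWeight (F q) n k k j)
      (fun q => c * (n.choose j : ℝ) * (q : ℝ) ^ ((j : ℤ) - (n : ℤ) + (k : ℤ))) := by
  have hchoose : (0 : ℝ) < n.choose j := by exact_mod_cast Nat.choose_pos hjn
  -- In n + 7, the square count contributes n + 5, the excluded zero vector 1, and the exceptional
  -- vectors 1.
  refine asympOn_of_mul_eq (K := n.choose j * (j + 5) + (n + 7)) (mul_pos hc hchoose) (by omega)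
    hj hk fun q hq => ?_
  obtain ⟨hqp, hqk⟩ := hS q hq
  have hcard := hF q hqp
  have : Finite (F q) := Nat.finite_of_card_ne_zero (by rw [hcard]; exact hqp.ne_zero)
  let _ : Fintype (F q) := Fintype.ofFinite _
  rw [Nat.card_eq_fintype_card] at hcard
  have hq1 : (1 : ℝ) ≤ q := by exact_mod_cast hqp.one_lt.le
  obtain ⟨a, b, r, m, ha, hb, hr, hm, heq⟩ := exists_averageWeight_mul_eq (F := F q) hk hj hn
    (nonempty_complementaryCodes_of_le_wittIndex hqk)
  have hc1 := hcount q hq _ hcard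
  rw [hcard] at ha hb hr hm heq
  refine ⟨hqp.one_lt.le, a, b, r, m, ha, hb, ?_, ?_, heq⟩
  · rw [card_isotropicOfWeight, Nat.cast_mul] at hr
    have h1 : |r - c * n.choose j * (q : ℝ) ^ (j - 1)| ≤ (q : ℝ) ^ (j - 2)
        + n.choose j * ((j + 5) * (q : ℝ) ^ (j - 2)) := by
      refine (abs_sub_le _ _ _).trans (add_le_add hr ?_)
      rw [show c * (n.choose j : ℝ) * (q : ℝ) ^ (j - 1) = n.choose j * (c * (q : ℝ) ^ (j - 1)) by
        ring, ← mul_sub, abs_mul, abs_of_pos hchoose]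
      gcongr
    refine h1.trans ?_
    have h2 : (0 : ℝ) ≤ (q : ℝ) ^ (j - 2) := by positivity
    have h3 : (0 : ℝ) ≤ n := by positivity
    nlinarith
  · obtain ⟨l, rfl⟩ := Nat.exists_eq_add_of_le' hn
    have h1 := abs_squareSumCount_sub_le (Finset.univ : Finset (F q)) (by simp) l 0
    have h2 := congrArg (Nat.cast : ℕ → ℝ) (card_isotropicVectors (F := F q) (n := l + 3))
    push_cast at h2
    rw [← h2, hcard] at h1
    simp only [show l + 3 - 2 = l + 1 by omega, show l + 3 - 1 = l + 2 by omega] at hm ⊢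
    have h3 : (1 : ℝ) ≤ (q : ℝ) ^ (l + 1) := one_le_pow₀ hq1
    have h4 : (0 : ℝ) ≤ (((l + 3).choose j : ℝ) * (j + 5)) * (q : ℝ) ^ (l + 1) := by positivity
    rw [abs_le] at *
    push_cast
    constructor <;> nlinarith

/-- If one coordinate of an isotropic pair vanishes, so does the other. -/
theorem isotropicOfWeight_two_of_length_two {K : Type*} [Field K] [Fintype K] :
    isotropicOfWeight K 2 2 = isotropicVectors K 2 := by
  classical
  refine (isotropicOfWeight_subset one_le_two).antisymm fun v hv => ?_
  simp only [isotropicOfWeight, isotropicVectors, Finset.mem_filter, Finset.mem_univ,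
    true_and] at hv ⊢
  refine ⟨hv.1, ?_⟩
  have h := hv.1
  rw [dotProduct, Fin.sum_univ_two] at h
  have h0 : v 0 ≠ 0 := fun h0 => hv.2 (funext fun i => by
    fin_cases i <;> simp_all)
  have h1 : v 1 ≠ 0 := fun h1 => h0 (by simp_all)
  have : (Finset.univ.filter fun i => v i ≠ 0) = Finset.univ := by
    ext i
    fin_cases i <;> simp [h0, h1]
  rw [hammingNorm]
  convert Finset.card_fin 2

theorem averageWeight_length_two {K : Type*} [Field K] [Fintype K]
    (hN : (complementaryCodes K 2 1 1).Nonempty) :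
    averageWeight K 2 1 1 2 = Fintype.card K - 1 := by
  classical
  have h := averageWeight_mul_card (F := K) (n := 2) (k := 1) one_le_two ∅ (fun u hu v hv => by
    rw [Finset.sdiff_empty, mem_isotropicVectors] at hu hv
    rw [ncard_codesThrough_one hu.1 hu.2, ncard_codesThrough_one hv.1 hv.2]) hN
  simp only [Finset.sdiff_empty, isotropicOfWeight_two_of_length_two, Finset.inter_empty,
    Finset.sum_empty, Nat.cast_zero, zero_div, sub_zero, zero_mul, add_zero, pow_one] at h
  have hI : ((isotropicVectors K 2).card : ℝ) ≠ 0 := by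
    rw [Nat.cast_ne_zero, Finset.card_ne_zero, Finset.nonempty_iff_ne_empty]
    intro h0
    have h1 := sum_isotropic_ncard_codesThrough (F := K) (n := 2) 1
    rw [h0, Finset.sum_empty, pow_one] at h1
    have h2 := (Set.ncard_pos (Set.toFinite _)).mpr hN
    have h3 := Fintype.one_lt_card (α := K)
    have h4 := Nat.mul_pos h2 (Nat.sub_pos_of_lt h3)
    omega
  rw [mul_comm] at h
  exact mul_left_cancel₀ hI h

theorem asympOn_averageWeight_length_two (hF : ∀ q, IsPrimePow q → Nat.card (F q) = q)
    {k : ℕ} (hk : 1 ≤ k) {S : Set ℕ} (hS : ∀ q ∈ S, IsPrimePow q ∧ k ≤ wittIndex (F q) 2) :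
    AsympOn S (fun q => averageWeight (F q) 2 k k 2)
      (fun q => ((2 : ℕ).choose 2 : ℝ) * (q : ℝ) ^ (((2 : ℕ) : ℤ) - ((2 : ℕ) : ℤ) + (k : ℤ))) := by
  refine tendsto_of_abs_sub_le_div (K := 1) fun q hq => ?_
  obtain ⟨hqp, hqk⟩ := hS q hq
  have hcard := hF q hqp
  have : Finite (F q) := Nat.finite_of_card_ne_zero (by rw [hcard]; exact hqp.ne_zero)
  let _ : Fintype (F q) := Fintype.ofFinite _
  rw [Nat.card_eq_fintype_card] at hcard
  obtain rfl : k = 1 := by have := two_mul_le_of_le_wittIndex hqk; omega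
  beta_reduce
  rw [averageWeight_length_two (nonempty_complementaryCodes_of_le_wittIndex hqk), hcard]
  have h0 : (0 : ℝ) < q := by exact_mod_cast hqp.pos
  simp only [Nat.choose_self, Nat.cast_one, one_mul, sub_self, zero_add, zpow_one]
  rw [div_sub_one h0.ne', sub_sub_cancel_left, abs_div, abs_of_pos h0]
  simp

theorem averageWeight_two_eq_zero {K : Type*} [Field K] [Fintype K] (n k : ℕ)
    (h : Fintype.card K % 4 = 3) : averageWeight K n k k 2 = 0 := by
  classical
  have hs : ¬ IsSquare (-1 : K) := by rw [FiniteField.isSquare_neg_one_iff]; omega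
  have h1 : squareSumCount ((Finset.univ : Finset K).erase 0) 2 0 = 0 := by
    rw [squareSumCount]
    refine Finset.sum_eq_zero fun a ha => ?_
    have ha0 : a ≠ 0 := by simpa using ha
    rw [squareSumCount_one, Finset.card_eq_zero, Finset.filter_eq_empty_iff]
    intro b _ hb
    -- A zero of a^2 + b^2 with a ≠ 0 would make -1 the square of b/a.
    exact hs ⟨b / a, by field_simp; rw [hb, zero_sub]⟩
  have h2 := card_isotropicOfWeight (F := K) (n := n) 2
  have h3 : (isotropicOfWeight K n 2).card = 0 := by
    rw [h2]
    convert mul_zero _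
  rw [averageWeight, aggregateWeight_eq_sum, Finset.card_eq_zero.mp h3]
  simp

end Asymptotics

end SelfOrthogonalCodes

/-- `F q` is a field with `q` elements for each prime power `q`. -/
theorem mainTheorem8 (F : ℕ → Type*) [∀ q, Field (F q)]
    (hF : ∀ q, IsPrimePow q → Nat.card (F q) = q)
    (n j k : ℕ) (hj : 2 ≤ j) (hjn : j ≤ n) (hk : 1 ≤ k) :
    -- the generic behaviour, `j ≥ 3`
    (3 ≤ j →
      SelfOrthogonalCodes.AsympOn
        {q | IsPrimePow q ∧ k ≤ SelfOrthogonalCodes.wittIndex (F q) n}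
        (fun q => SelfOrthogonalCodes.averageWeight (F q) n k k j)
        (fun q => (n.choose j : ℝ) * (q : ℝ) ^ ((j : ℤ) - (n : ℤ) + (k : ℤ)))) ∧
    -- the generic behaviour, `j = 2` and `q` even
    (j = 2 →
      SelfOrthogonalCodes.AsympOn
        {q | IsPrimePow q ∧ Even q ∧ k ≤ SelfOrthogonalCodes.wittIndex (F q) n}
        (fun q => SelfOrthogonalCodes.averageWeight (F q) n k k j)
        (fun q => (n.choose j : ℝ) * (q : ℝ) ^ ((j : ℤ) - (n : ℤ) + (k : ℤ)))) ∧
    -- `j = n = 2` and `q ≡ 1 (mod 4)`: still the generic behaviour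
    (j = 2 → n = 2 →
      SelfOrthogonalCodes.AsympOn
        {q | IsPrimePow q ∧ q % 4 = 1 ∧ k ≤ SelfOrthogonalCodes.wittIndex (F q) n}
        (fun q => SelfOrthogonalCodes.averageWeight (F q) n k k j)
        (fun q => (n.choose j : ℝ) * (q : ℝ) ^ ((j : ℤ) - (n : ℤ) + (k : ℤ)))) ∧
    -- exception: `j = 2`, `n ≥ 3` and `q ≡ 1 (mod 4)`
    (j = 2 → 3 ≤ n →
      SelfOrthogonalCodes.AsympOn
        {q | IsPrimePow q ∧ q % 4 = 1 ∧ k ≤ SelfOrthogonalCodes.wittIndex (F q) n}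
        (fun q => SelfOrthogonalCodes.averageWeight (F q) n k k j)
        (fun q => 2 * (n.choose 2 : ℝ) * (q : ℝ) ^ ((2 : ℤ) - (n : ℤ) + (k : ℤ)))) ∧
    -- exception: `j = 2` and `q ≡ 3 (mod 4)`
    (j = 2 → ∀ q, IsPrimePow q → q % 4 = 3 →
      k ≤ SelfOrthogonalCodes.wittIndex (F q) n →
      SelfOrthogonalCodes.averageWeight (F q) n k k j = 0) := by
  classical
  have hlarge : 3 ≤ j → ∀ q, ∀ _ : Fintype (F q), Fintype.card (F q) = q →
      |(SelfOrthogonalCodes.squareSumCount ((Finset.univ : Finset (F q)).erase 0) j 0 : ℝ)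
        - 1 * (q : ℝ) ^ (j - 1)| ≤ (j + 5) * (q : ℝ) ^ (j - 2) := by
    intro h3 q _ hq
    obtain ⟨m, rfl⟩ := Nat.exists_eq_add_of_le' h3
    have h := SelfOrthogonalCodes.abs_squareSumCount_sub_le
      ((Finset.univ : Finset (F q)).erase 0)
      (by rw [Finset.card_erase_add_one (Finset.mem_univ _), Finset.card_univ]) m 0
    rw [hq] at h
    rw [one_mul, show m + 3 - 1 = m + 2 by omega, show m + 3 - 2 = m + 1 by omega]
    refine h.trans_eq ?_
    push_cast
    ring
  refine ⟨fun h3 => ?_, ?_, ?_, ?_, ?_⟩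
  · simpa only [one_mul] using SelfOrthogonalCodes.asympOn_averageWeight hF (h3.trans hjn) hj hjn
      hk (S := {q | IsPrimePow q ∧ k ≤ SelfOrthogonalCodes.wittIndex (F q) n})
      (fun q hq => hq) one_pos fun q _ => hlarge h3 q
  · rintro rfl
    rcases hjn.eq_or_lt with rfl | hn
    · exact SelfOrthogonalCodes.asympOn_averageWeight_length_two hF hk fun q hq =>
        ⟨hq.1, hq.2.2⟩
    · have h := SelfOrthogonalCodes.asympOn_averageWeight hF hn hj hjn hk
        (S := {q | IsPrimePow q ∧ Even q ∧ k ≤ SelfOrthogonalCodes.wittIndex (F q) n})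
        (fun q hq => ⟨hq.1, hq.2.2⟩) one_pos fun q hq _ hcard => ?_
      · simpa only [one_mul] using h
      have h2 : ringChar (F q) = 2 :=
        FiniteField.even_card_iff_char_two.mpr (by rw [hcard]; exact Nat.even_iff.mp hq.2.1)
      have h := SelfOrthogonalCodes.abs_squareSumCount_two_sub_le_of_char_two
        ((Finset.univ : Finset (F q)).erase 0)
        (by rw [Finset.card_erase_add_one (Finset.mem_univ _), Finset.card_univ]) h2 0
      rw [hcard] at h
      rw [one_mul, show 2 - 1 = 1 from rfl, pow_one, Nat.sub_self, pow_zero, mul_one]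
      exact h.trans (by norm_num)
  · rintro rfl rfl
    exact SelfOrthogonalCodes.asympOn_averageWeight_length_two hF hk fun q hq => ⟨hq.1, hq.2.2⟩
  · rintro rfl hn
    refine SelfOrthogonalCodes.asympOn_averageWeight hF hn hj hjn hk
      (fun q hq => ⟨hq.1, hq.2.2⟩) two_pos fun q hq _ hcard => ?_
    have hmod : q % 4 = 1 := hq.2.1
    have h2 : ringChar (F q) ≠ 2 := by
      rw [Ne, FiniteField.even_card_iff_char_two, hcard]
      omega
    have hs : IsSquare (-1 : F q) := by
      rw [FiniteField.isSquare_neg_one_iff, hcard]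
      omega
    rw [SelfOrthogonalCodes.squareSumCount_two_zero_of_isSquare_neg_one h2 hs, hcard,
      Nat.cast_mul, Nat.cast_sub hq.1.one_lt.le, Nat.sub_self, pow_zero,
      show 2 - 1 = 1 from rfl, pow_one]
    push_cast
    rw [mul_sub, mul_one, sub_sub_cancel_left]
    norm_num
  · rintro rfl q hq hmod -
    have hcard := hF q hq
    have : Finite (F q) := Nat.finite_of_card_ne_zero (by rw [hcard]; exact hq.ne_zero)
    let _ : Fintype (F q) := Fintype.ofFinite _
    rw [Nat.card_eq_fintype_card] at hcard
    exact SelfOrthogonalCodes.averageWeight_two_eq_zero n k (by rw [hcard]; exact hmod)
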